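/- All topological groups are assumed Hausdorff. A totally disconnected locally compact contraction group is a pair $(G,\alpha)$ consisting of a totally disconnected, locally compact group $G$ and an automorphism $\alpha$ of the topological group $G$ (so $\alpha$ and $\alpha^{-1}$ are continuous) such that $\lim_{n\to\infty}\alpha^n(x)=e$ for each $x\in G$. An isomorphism $(G,\alpha)\to(H,\beta)$ of such pairs is an isomorphism $\phi\colon G\to H$ of topological groups with $\phi\circ\alpha=\beta\circ\phi$. For a finite group $F$, let $F^{(-\mathbb N)}\times F^{\mathbb N_0}$ be the group of all sequences $(x_n)_{n\in\mathbb Z}$ in $F$ with $x_n=e$ for all but finitely many $n<0$, where the group $F^{(-\mathbb N)}$ of finitely supported sequences indexed by the negative integers is given the discrete topology, $F^{\mathbb N_0}$ the product topology (with $F$ discrete), and $F^{(-\mathbb N)}\times F^{\mathbb N_0}$ the product of these topologies; the right shift is the automorphism $(x_n)_{n\in\mathbb Z}\mapsto(x_{n-1})_{n\in\mathbb Z}$. **Theorem D.** Let $(G,\alpha)$ be a totally disconnected, locally compact contraction group such that $G$ is abelian and a torsion group. Then there is a finite abelian group $F$ such that $(G,\alpha)$ is isomorphic to $F^{(-\mathbb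 N)}\times F^{\mathbb N_0}$ with the right shift, and $F$ is determined by $(G,\alpha)$ up to isomorphism. Conversely, for every finite abelian group $F$, the group $F^{(-\mathbb N)}\times F^{\mathbb N_0}$ with the right shift, and hence every pair $(G,\alpha)$ isomorphic to it, is a totally disconnected, locally compact contraction group whose underlying group is an abelian torsion group. -/

import Mathlib

universe u v w

open Filter Topology

/-- `(G, α)` is a totally disconnected, locally compact contraction group: `G` is a totally
disconnected, locally compact Hausdorff topological group, and the (bicontinuous) automorphism
`α` of `G` is contractive, i.e. `α ^ n (x) → e` for each `x` in `G`. -/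
structure IsTDLCContractionGroup (G : Type u) [Group G] [TopologicalSpace G]
    (α : G ≃ₜ* G) : Prop where
  isTopologicalGroup : IsTopologicalGroup G
  t2Space : T2Space G
  locallyCompactSpace : LocallyCompactSpace G
  totallyDisconnectedSpace : TotallyDisconnectedSpace G
  contractive : ∀ x : G, Tendsto (fun n : ℕ => (⇑α)^[n] x) atTop (𝓝 1)

/-- `(G, α)` and `(H, β)` are isomorphic as contraction groups: there is an equivariant
isomorphism of topological groups. -/
def ContractionGroupIso {G : Type u} {H : Type v} [Group G] [TopologicalSpace G]
    [Group H] [TopologicalSpace H] (α : G ≃ₜ* G) (β : H ≃ₜ* H) : Prop :=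
  ∃ φ : G ≃ₜ* H, ∀ x : G, φ (α x) = β (φ x)

/-- The group `F^(-ℕ)` of finitely supported sequences indexed by `-1, -2, -3, …`; the
entry with index `-(k + 1)` is stored at `k : ℕ`. -/
def finSuppSeq (F : Type u) [Group F] : Subgroup (ℕ → F) where
  carrier := {x | (Function.mulSupport x).Finite}
  one_mem' := by simp
  mul_mem' {x y} hx hy := (Set.Finite.union hx hy).subset (Function.mulSupport_mul x y)
  inv_mem' {x} hx := by
    have h : (Function.mulSupport x).Finite := hx
    simpa [Function.mulSupport_inv] using h

/-- The group `F^(-ℕ) × F^(ℕ₀)`. -/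
def ShiftGroup (F : Type u) [Group F] : Type u := finSuppSeq F × (ℕ → F)

namespace ShiftGroup

variable {F : Type u} [Group F]

instance : Group (ShiftGroup F) := inferInstanceAs (Group (finSuppSeq F × (ℕ → F)))

/-- The discrete topology on `F^(-ℕ)`, times the product topology on `F^(ℕ₀)` with `F`
discrete. -/
instance : TopologicalSpace (ShiftGroup F) :=
  @instTopologicalSpaceProd (finSuppSeq F) (ℕ → F) ⊥
    (@Pi.topologicalSpace ℕ (fun _ => F) (fun _ => ⊥))

/-- The entry `x_n`, `n : ℤ`, of an element of `F^(-ℕ) × F^(ℕ₀)` regarded as a two-sided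
sequence. -/
def entry (x : ShiftGroup F) : ℤ → F
  | Int.ofNat n => x.2 n
  | Int.negSucc k => x.1.1 k

/-- The right shift on underlying sets. -/
def shiftFun (x : ShiftGroup F) : ShiftGroup F :=
  (⟨fun k => x.1.1 (k + 1), x.1.2.preimage (Nat.succ_injective.injOn)⟩,
    fun n => Nat.casesOn n (x.1.1 0) (fun m => x.2 m))

/-- The left shift on underlying sets, inverse to the right shift. -/
def unshiftFun (x : ShiftGroup F) : ShiftGroup F :=
  (⟨fun k => Nat.casesOn k (x.2 0) (fun m => x.1.1 m), by
      refine ((x.1.2.image Nat.succ).insert 0).subset ?_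
      rintro (_ | k) hk
      · exact Set.mem_insert _ _
      · exact Set.mem_insert_of_mem _ ⟨k, hk, rfl⟩⟩,
    fun n => x.2 (n + 1))

theorem continuous_shiftFun : Continuous (shiftFun : ShiftGroup F → ShiftGroup F) := by
  let _ : TopologicalSpace F := ⊥
  let _ : TopologicalSpace (finSuppSeq F) := ⊥
  have : DiscreteTopology F := ⟨rfl⟩
  have : DiscreteTopology (finSuppSeq F) := ⟨rfl⟩
  have h : Continuous (fun x : finSuppSeq F × (ℕ → F) =>
      (shiftFun (F := F) x : finSuppSeq F × (ℕ → F))) := by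
    refine Continuous.prodMk ?_ (continuous_pi ?_)
    · exact (continuous_of_discreteTopology (f := fun y : finSuppSeq F =>
        (shiftFun (F := F) (y, 1)).1)).comp continuous_fst
    · rintro (_ | n)
      · exact (continuous_of_discreteTopology (f := fun y : finSuppSeq F => y.1 0)).comp
          continuous_fst
      · exact (continuous_apply n).comp continuous_snd
  exact h

theorem continuous_unshiftFun : Continuous (unshiftFun : ShiftGroup F → ShiftGroup F) := by
  let _ : TopologicalSpace F := ⊥
  let _ : TopologicalSpace (finSuppSeq F) := ⊥
  have : DiscreteTopology F := ⟨rfl⟩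
  have : DiscreteTopology (finSuppSeq F) := ⟨rfl⟩
  have h : Continuous (fun x : finSuppSeq F × (ℕ → F) =>
      (unshiftFun (F := F) x : finSuppSeq F × (ℕ → F))) := by
    refine Continuous.prodMk ?_ (continuous_pi ?_)
    · exact (continuous_of_discreteTopology (f := fun y : finSuppSeq F × F =>
        (unshiftFun (F := F) (y.1, fun _ => y.2)).1)).comp
        (continuous_fst.prodMk ((continuous_apply 0).comp continuous_snd))
    · intro n
      exact (continuous_apply (n + 1)).comp continuous_snd
  exact h

/-- The right shift `(x_n)_n ↦ (x_(n-1))_n` as an automorphism of the topological group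
`F^(-ℕ) × F^(ℕ₀)`. -/
def shift (F : Type u) [Group F] : ShiftGroup F ≃ₜ* ShiftGroup F where
  toFun := shiftFun
  invFun := unshiftFun
  left_inv x := by
    refine Prod.ext (Subtype.ext (funext ?_)) rfl
    rintro (_ | k) <;> rfl
  right_inv x := by
    refine Prod.ext rfl (funext ?_)
    rintro (_ | k) <;> rfl
  map_mul' x y := by
    refine Prod.ext rfl (funext ?_)
    rintro (_ | k) <;> rfl
  continuous_toFun := continuous_shiftFun
  continuous_invFun := continuous_unshiftFun

theorem entry_shift (x : ShiftGroup F) (n : ℤ) : (shift F x).entry n = x.entry (n - 1) := by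
  rcases n with (_ | n) | k
  · rfl
  · have : (Int.ofNat (n + 1) - 1 : ℤ) = Int.ofNat n := by simp
    rw [this]; rfl
  · rfl

end ShiftGroup

/-! Existence. Write `G` additively as `M`, with automorphism `a`. A Baire argument gives a compact
open subgroup `V` with `a V ⊆ V`; the subgroups `a ^ n (V)` form a basis at `0` and exhaust `M`.
Hence `∑ f_n • a ^ n x` converges for every integral Laurent series `f`, and `M` becomes a module
over `ℤ((X))`. This ring is a principal ideal domain, and `M` is finitely generated because `V / aV`
is finite (digit expansions). As `M` is torsion, it is a finite sum of cyclic modules whose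
annihilators contain nonzero integers. Prime numbers stay prime in `ℤ((X))`, so each annihilator is
generated by an integer `q i`, and `ℤ((X)) / (q i)` is `(ℤ/q i)((X))`, the shift group of `ℤ/q i`.
The resulting bijection from a shift group is continuous, and open by the open mapping theorem.

Uniqueness. An equivariant isomorphism of shift groups displaces starting positions of sequences by
a bounded amount. Comparing homomorphisms from a finite group `A` into long windows gives `|Hom(A,
F)| ^ N ≤ |Hom(A, F')| ^ (N + e)` for all `N`, so by symmetry the two counts agree. They determine
the numbers of injective homomorphisms, whence `F` and `F'` embed in each other. -/

/-! ### Arithmetic of Laurent series. -/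

namespace LaurentSeries

open PowerSeries

theorem intCast_eq_single (m : ℤ) : (m : LaurentSeries ℤ) = HahnSeries.single 0 m := by
  exact (map_intCast (HahnSeries.C : ℤ →+* LaurentSeries ℤ) m).symm

theorem coeff_intCast_mul (m : ℤ) (f : LaurentSeries ℤ) (n : ℤ) :
    ((m : LaurentSeries ℤ) * f).coeff n = m * f.coeff n := by
  rw [intCast_eq_single, HahnSeries.coeff_single_zero_mul]

theorem intCast_dvd_iff (m : ℤ) (f : LaurentSeries ℤ) :
    (m : LaurentSeries ℤ) ∣ f ↔ ∀ n, m ∣ f.coeff n := by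
  constructor
  · rintro ⟨g, rfl⟩ n
    exact ⟨g.coeff n, coeff_intCast_mul m g n⟩
  · intro h
    rcases eq_or_ne m 0 with rfl | hm
    · have : f = 0 := by
        ext n
        simpa using h n
      simp [this]
    -- Integer division is not additive, but it preserves zero, which is all that coefficientwise
    -- mapping needs.
    · refine ⟨f.map (⟨fun k => k / m, by simp⟩ : ZeroHom ℤ ℤ), ?_⟩
      ext n
      rw [coeff_intCast_mul]
      exact (Int.mul_ediv_cancel' (h n)).symm

/-- Coefficientwise application of a ring homomorphism commutes with multiplication. -/
theorem map_mul_ringHom {R S : Type*} [CommRing R] [CommRing S] (φ : R →+* S)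
    (f g : LaurentSeries R) : (f * g).map φ = f.map φ * g.map φ := by
  have hsupp (h : LaurentSeries R) : (h.map φ).support ⊆ h.support := by
    intro n hn hn'
    exact hn (by simp [show h.coeff n = 0 from hn'])
  ext n
  rw [HahnSeries.map_coeff, HahnSeries.coeff_mul, map_sum,
    HahnSeries.coeff_mul_left' f.isPWO_support (hsupp f)]
  simp only [map_mul]
  -- Mapping may shrink supports; the extra terms contain a vanishing coefficient of `g.map φ`.
  refine (Finset.sum_subset ?_ ?_).symm
  · intro p hp
    rw [Finset.mem_antidiagonal] at hp ⊢
    exact ⟨hp.1, hsupp g hp.2.1, hp.2.2⟩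
  · intro p hp hp'
    rw [Finset.mem_antidiagonal] at hp hp'
    have : (g.map φ).coeff p.2 = 0 := by
      by_contra h
      exact hp' ⟨hp.1, h, hp.2.2⟩
    rw [HahnSeries.map_coeff] at this
    rw [this, mul_zero]

/-- The multiples of `p` are the kernel of reduction modulo `p`, whose target, Laurent series over a
field, is a domain. -/
theorem prime_intCast {p : ℤ} (hp : Prime p) : Prime (p : LaurentSeries ℤ) := by
  have key (f : LaurentSeries ℤ) : (p : LaurentSeries ℤ) ∣ f ↔
      f.map (Int.castRingHom (ZMod p.natAbs)) = 0 := by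
    rw [intCast_dvd_iff, HahnSeries.ext_iff, funext_iff]
    refine forall_congr' fun n => ?_
    simp [ZMod.intCast_zmod_eq_zero_iff_dvd, ZMod.intCast_zmod_eq_zero_iff_dvd]
  have : Fact p.natAbs.Prime := ⟨Int.prime_iff_natAbs_prime.mp hp⟩
  refine ⟨by simpa [intCast_eq_single] using hp.ne_zero, ?_, fun f g h => ?_⟩
  · intro hu
    have h1 := (intCast_dvd_iff p 1).mp (isUnit_iff_dvd_one.mp hu) 0
    exact hp.not_isUnit (isUnit_iff_dvd_one.mpr (by simpa using h1))
  · rw [key, map_mul_ringHom, mul_eq_zero] at h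
    rwa [key, key]

/-- Every divisor of a nonzero integer in the ring of integral Laurent series is associated to
a positive integer. -/
theorem exists_associated_natCast {m : ℕ} (hm : m ≠ 0) :
    ∀ f : LaurentSeries ℤ, f ∣ m → ∃ q : ℕ, q ≠ 0 ∧ Associated f q := by
  induction m using induction_on_primes with
  | zero => exact absurd rfl hm
  | one =>
    intro f hf
    refine ⟨1, one_ne_zero, ?_⟩
    simpa using associated_one_iff_isUnit.mpr (isUnit_of_dvd_one (by simpa using hf))
  | prime_mul p a hp ih =>
    have ha : a ≠ 0 := right_ne_zero_of_mul hm
    have hpr : Prime (p : LaurentSeries ℤ) := by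
      simpa using prime_intCast (Nat.prime_iff_prime_int.mp hp)
    rintro f ⟨g, hg⟩
    rw [Nat.cast_mul] at hg
    -- The prime `p` splits off either `f` or its cofactor; cancelling it leaves a divisor of `a`.
    rcases hpr.dvd_or_dvd (⟨_, hg.symm⟩ : (p : LaurentSeries ℤ) ∣ f * g) with ⟨f', rfl⟩ | ⟨g', rfl⟩
    · rw [mul_assoc] at hg
      obtain ⟨q, hq, hfq⟩ := ih ha f' ⟨g, mul_left_cancel₀ hpr.ne_zero hg⟩
      refine ⟨p * q, mul_ne_zero hp.ne_zero hq, ?_⟩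
      rw [Nat.cast_mul]
      exact hfq.mul_left _
    · rw [mul_left_comm] at hg
      exact ih ha f ⟨g', mul_left_cancel₀ hpr.ne_zero hg⟩

/-- Laurent series over a principal ideal domain form a principal ideal ring. -/
theorem isPrincipalIdealRing (R : Type*) [CommRing R] [IsDomain R] [IsPrincipalIdealRing R] :
    IsPrincipalIdealRing (LaurentSeries R) := by
  -- A prime `P` is extended from its contraction `Q` to power series, and `X ∉ Q` because `X`
  -- becomes a unit. For such `Q`, a generator of the ideal of constant coefficients lifts to a
  -- generator of `Q`.
  refine IsPrincipalIdealRing.of_prime fun P hP => ?_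
  have hloc := LaurentSeries.of_powerSeries_localization (R := R)
  have hmap := IsLocalization.map_under (Submonoid.powers (X : R⟦X⟧)) (LaurentSeries R) P
  set Q := P.under R⟦X⟧ with hQ
  have hQp : Q.IsPrime := hP.comap _
  have hX : X ∉ Q := fun hX => hP.ne_top
    (P.eq_top_of_isUnit_mem (x := algebraMap R⟦X⟧ (LaurentSeries R) X) hX
      (IsLocalization.map_units (LaurentSeries R)
        (⟨X, Submonoid.mem_powers X⟩ : Submonoid.powers (X : R⟦X⟧))))
  obtain ⟨a, ha⟩ := (IsPrincipalIdealRing.principal (Q.map constantCoeff)).principal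
  obtain ⟨T, hT, -, hcard⟩ := exist_eq_span_eq_ncard_of_X_notMem hX (S := {a}) ha.symm
    (Set.finite_singleton a)
  obtain ⟨t, rfl⟩ := Set.ncard_eq_one.mp (hcard.trans (Set.ncard_singleton a))
  refine ⟨⟨algebraMap R⟦X⟧ (LaurentSeries R) t, ?_⟩⟩
  rw [← hmap, hT, Ideal.map_span, Set.image_singleton]

end LaurentSeries

/-! ### Finite abelian groups are determined by homomorphism counts. -/

section HomCount

/-- A homomorphism out of a group is a normal subgroup together with an injective
homomorphism out of the quotient. -/
theorem MonoidHom.card_eq_sum_card_injective (A : Type u) (F : Type v) [CommGroup A] [Finite A]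
    [Group F] [Finite F] [Fintype (Subgroup A)] :
    Nat.card (A →* F) =
      ∑ N : Subgroup A, Nat.card {g : A ⧸ N →* F // Function.Injective g} := by
  have (N : Subgroup A) : Finite (A ⧸ N →* F) := DFunLike.finite _
  rw [← Nat.card_sigma]
  symm
  refine Nat.card_eq_of_bijective
    (fun p : Σ N : Subgroup A, {g : A ⧸ N →* F // Function.Injective g} =>
      p.2.1.comp (QuotientGroup.mk' p.1)) ⟨?_, ?_⟩
  · rintro ⟨N, g, hg⟩ ⟨N', g', hg'⟩ h
    have hker (N : Subgroup A) (g : A ⧸ N →* F) (hg : Function.Injective g) :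
        (g.comp (QuotientGroup.mk' N)).ker = N := by
      ext x
      simp [MonoidHom.mem_ker, map_eq_one_iff g hg]
    obtain rfl : N = N' := by
      rw [← hker N g hg, ← hker N' g' hg']
      exact congrArg MonoidHom.ker h
    obtain rfl : g = g' := QuotientGroup.monoidHom_ext _ h
    rfl
  · intro f
    exact ⟨⟨f.ker, QuotientGroup.kerLift f, QuotientGroup.kerLift_injective f⟩, by ext; rfl⟩

theorem card_injective_hom_congr {A B : Type*} [Group A] [Group B] (e : A ≃* B) (H : Type*)
    [Group H] : Nat.card {g : A →* H // Function.Injective g} =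
      Nat.card {g : B →* H // Function.Injective g} :=
  Nat.card_congr (e.monoidHomCongrLeftEquiv.subtypeEquiv fun g =>
    (Function.Injective.of_comp_iff' g e.symm.bijective).symm)

/-- Sort homomorphisms by kernel `N`. Proper quotients of `A` are smaller, so by induction the terms
with `N ≠ ⊥` agree; hence so do the terms with `N = ⊥`. -/
theorem card_injective_hom_eq {F : Type v} {F' : Type w} [Group F] [Finite F] [Group F']
    [Finite F'] (h : ∀ (A : Type u) [CommGroup A] [Finite A],
      Nat.card (A →* F) = Nat.card (A →* F')) (n : ℕ) :
    ∀ (A : Type u) [CommGroup A] [Finite A], Nat.card A = n →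
      Nat.card {g : A →* F // Function.Injective g} =
        Nat.card {g : A →* F' // Function.Injective g} := by
  induction n using Nat.strong_induction_on with
  | _ n ih =>
    intro A _ _ hA
    classical
    have : Fintype (Subgroup A) := Fintype.ofFinite _
    have key := h A
    rw [MonoidHom.card_eq_sum_card_injective, MonoidHom.card_eq_sum_card_injective,
      ← Finset.add_sum_erase _ _ (Finset.mem_univ (⊥ : Subgroup A)),
      ← Finset.add_sum_erase _ _ (Finset.mem_univ (⊥ : Subgroup A))] at key
    have hsum : ∑ N ∈ Finset.univ.erase (⊥ : Subgroup A),
          Nat.card {g : A ⧸ N →* F // Function.Injective g} =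
        ∑ N ∈ Finset.univ.erase (⊥ : Subgroup A),
          Nat.card {g : A ⧸ N →* F' // Function.Injective g} := by
      refine Finset.sum_congr rfl fun N hN => ih _ ?_ _ rfl
      have h1 : 1 < Nat.card N := (Subgroup.one_lt_card_iff_ne_bot N).mpr (Finset.ne_of_mem_erase hN)
      have h2 := Subgroup.card_eq_card_quotient_mul_card_subgroup N
      have h3 : 0 < Nat.card (A ⧸ N) := Nat.card_pos
      rw [← hA, h2]
      exact lt_mul_of_one_lt_right h3 h1
    rw [hsum, Nat.add_right_cancel_iff] at key
    rw [card_injective_hom_congr (QuotientGroup.quotientBot (G := A)) F,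
      card_injective_hom_congr (QuotientGroup.quotientBot (G := A)) F'] at key
    exact key

/-- Finite commutative groups which receive equally many homomorphisms from each finite
commutative group are isomorphic. -/
theorem nonempty_mulEquiv_of_card_hom_eq {F : Type v} {F' : Type w} [CommGroup F] [Finite F]
    [CommGroup F'] [Finite F']
    (h : ∀ (A : Type v) [CommGroup A] [Finite A], Nat.card (A →* F) = Nat.card (A →* F'))
    (h' : ∀ (A : Type w) [CommGroup A] [Finite A], Nat.card (A →* F) = Nat.card (A →* F')) :
    Nonempty (F ≃* F') := by
  -- The identities of `F` and `F'` are injective, so equal counts force embeddings both ways.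
  have h1 := card_injective_hom_eq h _ F rfl
  have h2 := card_injective_hom_eq h' _ F' rfl
  have : Finite (F →* F) := DFunLike.finite _
  have : Finite (F' →* F') := DFunLike.finite _
  have h3 : 0 < Nat.card {g : F →* F // Function.Injective g} :=
    Nat.card_pos_iff.mpr ⟨⟨MonoidHom.id F, Function.injective_id⟩, inferInstance⟩
  have h4 : 0 < Nat.card {g : F' →* F' // Function.Injective g} :=
    Nat.card_pos_iff.mpr ⟨⟨MonoidHom.id F', Function.injective_id⟩, inferInstance⟩
  obtain ⟨g, hg⟩ := (Nat.card_pos_iff.mp (h1 ▸ h3)).1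
  obtain ⟨g', hg'⟩ := (Nat.card_pos_iff.mp (h2.symm ▸ h4)).1
  have hcard : Nat.card F = Nat.card F' :=
    le_antisymm (Nat.card_le_card_of_injective g hg) (Nat.card_le_card_of_injective g' hg')
  exact ⟨MulEquiv.ofBijective g ((Nat.bijective_iff_injective_and_card g).mpr ⟨hg, hcard⟩)⟩

end HomCount

/-- An equivariant homomorphism intertwines all integral powers of the automorphisms. -/
theorem MulAut.map_zpow_apply_of_semiconj {G H : Type*} [Group G] [Group H] {σ : MulAut G}
    {τ : MulAut H} {φ : G →* H} (h : ∀ x, φ (σ x) = τ (φ x)) (n : ℤ) (x : G) :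
    φ ((σ ^ n) x) = (τ ^ n) (φ x) := by
  have h' (x : G) : φ (σ⁻¹ x) = τ⁻¹ (φ x) := by
    rw [← MulAut.inv_apply_self _ τ (φ (σ⁻¹ x)), ← h, MulAut.apply_inv_self]
  induction n generalizing x with
  | zero => simp
  | succ n ih => rw [zpow_add_one, zpow_add_one, MulAut.mul_apply, MulAut.mul_apply, ih, h]
  | pred n ih => rw [zpow_sub_one, zpow_sub_one, MulAut.mul_apply, MulAut.mul_apply, ih, h']

theorem MulAut.iterate_eq_pow {G : Type*} [Group G] (σ : MulAut G) (n : ℕ) :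
    (⇑σ)^[n] = ⇑(σ ^ n) := by
  induction n with
  | zero => rfl
  | succ n ih => rw [Function.iterate_succ, ih, pow_succ]; rfl

/-- Otherwise `(s / t) ^ N` would outgrow the constant `t ^ e`. -/
theorem le_of_forall_pow_le_pow_add {s t e : ℕ} (ht : 0 < t) (h : ∀ N, s ^ N ≤ t ^ (N + e)) :
    s ≤ t := by
  by_contra! hlt
  have ht' : (0 : ℝ) < t := by exact_mod_cast ht
  obtain ⟨N, hN⟩ := pow_unbounded_of_one_lt ((t : ℝ) ^ e)
    (show (1 : ℝ) < (s : ℝ) / t by rw [one_lt_div ht']; exact_mod_cast hlt)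
  rw [div_pow, lt_div_iff₀ (by positivity), ← pow_add, add_comm] at hN
  exact absurd (h N) (not_le.mpr (by exact_mod_cast hN))

/-! ### Shift groups in terms of entries. -/

namespace ShiftGroup

section Entries

variable {F : Type u} [Group F]

theorem ext_entry {x y : ShiftGroup F} (h : ∀ n, x.entry n = y.entry n) : x = y :=
  Prod.ext (Subtype.ext (funext fun k => h (Int.negSucc k))) (funext fun n => h (Int.ofNat n))

/-- The `n`-th entry, as a homomorphism. -/
def entryHom (F : Type u) [Group F] (n : ℤ) : ShiftGroup F →* F where
  toFun x := x.entry n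
  map_one' := by cases n <;> rfl
  map_mul' x y := by cases n <;> rfl

@[simp]
theorem entryHom_apply (n : ℤ) (x : ShiftGroup F) : entryHom F n x = x.entry n := rfl

@[simp]
theorem entry_one (n : ℤ) : (1 : ShiftGroup F).entry n = 1 := map_one (entryHom F n)

theorem entry_mul (x y : ShiftGroup F) (n : ℤ) : (x * y).entry n = x.entry n * y.entry n :=
  map_mul (entryHom F n) x y

theorem entry_div (x y : ShiftGroup F) (n : ℤ) : (x / y).entry n = x.entry n / y.entry n :=
  map_div (entryHom F n) x y

theorem exists_entry_eq_one (x : ShiftGroup F) : ∃ N : ℤ, ∀ n < N, x.entry n = 1 := by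
  obtain ⟨K, hK⟩ := x.1.2.bddAbove
  refine ⟨-(K + 1 : ℤ), ?_⟩
  rintro (n | k) hn
  · have : (0 : ℤ) ≤ Int.ofNat n := Int.natCast_nonneg n
    omega
  · by_contra hk
    have := hK (show k ∈ Function.mulSupport x.1.1 from hk)
    omega

/-- The element with prescribed entries, almost all of which are trivial at negative indices. -/
def ofEntries (f : ℤ → F) (N : ℤ) (hf : ∀ n < N, f n = 1) : ShiftGroup F :=
  (⟨fun k => f (Int.negSucc k), (Set.finite_Iic (-N).toNat).subset fun k hk => by
    by_contra h
    refine hk (hf _ ?_)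
    simp only [Set.mem_Iic] at h
    omega⟩, fun n => f (Int.ofNat n))

@[simp]
theorem entry_ofEntries (f : ℤ → F) (N : ℤ) (hf : ∀ n < N, f n = 1) (n : ℤ) :
    (ofEntries f N hf).entry n = f n := by
  cases n <;> rfl

/-- A basic neighbourhood constrains all negative entries, by discreteness, but only finitely many
others. -/
theorem mem_nhds_one_iff {U : Set (ShiftGroup F)} :
    U ∈ 𝓝 1 ↔ ∃ N : ℤ, ∀ x : ShiftGroup F, (∀ n < N, x.entry n = 1) → x ∈ U := by
  let _ : TopologicalSpace F := ⊥
  let _ : TopologicalSpace (finSuppSeq F) := ⊥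
  have : DiscreteTopology F := ⟨rfl⟩
  have : DiscreteTopology (finSuppSeq F) := ⟨rfl⟩
  have hnhds : U ∈ 𝓝 (1 : ShiftGroup F) ↔
      ∃ s ∈ 𝓝 (1 : finSuppSeq F), ∃ t ∈ 𝓝 (1 : ℕ → F), s ×ˢ t ⊆ U := mem_nhds_prod_iff
  rw [hnhds, nhds_discrete]
  constructor
  · rintro ⟨s, hs, t, ht, hst⟩
    obtain ⟨t', ht', hto, h1⟩ := mem_nhds_iff.mp ht
    obtain ⟨I, u, hu, hI⟩ := isOpen_pi_iff.mp hto 1 h1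
    obtain ⟨K, hK⟩ := I.bddAbove
    refine ⟨K + 1, fun x hx => hst ⟨?_, ht' (hI fun n hn => ?_)⟩⟩
    · have : x.1 = 1 := Subtype.ext (funext fun k => hx (Int.negSucc k) (by omega))
      simpa [this] using hs
    · have h : x.2 n = 1 := hx (Int.ofNat n) (by
        have := hK hn
        simp only [Int.ofNat_eq_natCast]
        omega)
      rw [h]
      exact (hu n hn).2
  · rintro ⟨N, hN⟩
    refine ⟨{1}, by simp, (Finset.range N.toNat : Set ℕ).pi fun _ => {1}, ?_, ?_⟩
    · exact set_pi_mem_nhds (Finset.finite_toSet _) fun n _ => by simp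
    · rintro ⟨x, y⟩ ⟨hx, hy⟩
      obtain rfl : x = 1 := hx
      refine hN _ ?_
      rintro (n | k) hn
      · exact hy n (by simpa using hn)
      · rfl

end Entries

/-- The right shift as an element of the automorphism group. -/
def shiftAut (F : Type u) [Group F] : MulAut (ShiftGroup F) := (shift F).toMulEquiv

theorem shiftAut_apply {F : Type u} [Group F] (x : ShiftGroup F) : shiftAut F x = shift F x := rfl

theorem entry_shiftAut_zpow {F : Type u} [Group F] (k : ℤ) (x : ShiftGroup F) (n : ℤ) :
    ((shiftAut F ^ k) x).entry n = x.entry (n - k) := by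
  have h (x : ShiftGroup F) (n : ℤ) : ((shiftAut F)⁻¹ x).entry n = x.entry (n + 1) := by
    have := entry_shift ((shiftAut F)⁻¹ x) (n + 1)
    rw [← shiftAut_apply, MulAut.apply_inv_self, add_sub_cancel_right] at this
    exact this.symm
  induction k generalizing x with
  | zero => simp
  | succ k ih =>
    rw [zpow_add_one, MulAut.mul_apply, ih, shiftAut_apply, entry_shift]
    congr 1; ring
  | pred k ih =>
    rw [zpow_sub_one, MulAut.mul_apply, ih, h]
    congr 1; ring

/-! ### Uniqueness of the finite group. -/

section Uniqueness

variable {F : Type v} {F' : Type w} [Group F] [Group F']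

/-- Continuity at `1` gives a bound `K` for one neighbourhood; conjugating by the shift to the power
`K - N` makes it uniform in `N`. -/
theorem exists_entry_map_eq_one {φ : ShiftGroup F →* ShiftGroup F'} (hφ : Continuous φ)
    (h : ∀ x, φ (shift F x) = shift F' (φ x)) :
    ∃ c : ℕ, ∀ (N : ℤ) (x : ShiftGroup F), (∀ n < N, x.entry n = 1) →
      ∀ n < N - c, (φ x).entry n = 1 := by
  have hU : {y : ShiftGroup F' | ∀ n < 0, y.entry n = 1} ∈ 𝓝 (φ 1) := by
    rw [map_one]
    exact mem_nhds_one_iff.mpr ⟨0, fun x hx => hx⟩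
  obtain ⟨K, hK⟩ := mem_nhds_one_iff.mp (hφ.continuousAt hU)
  refine ⟨K.toNat, fun N x hx n hn => ?_⟩
  have h1 : ∀ n < K, ((shiftAut F ^ (K - N)) x).entry n = 1 := fun n hn => by
    rw [entry_shiftAut_zpow]
    exact hx _ (by omega)
  have h2 := hK _ h1 (n + (K - N)) (by omega)
  rw [MulAut.map_zpow_apply_of_semiconj (σ := shiftAut F) (τ := shiftAut F') h,
    entry_shiftAut_zpow, add_sub_cancel_right] at h2
  exact h2

/-- A finite sequence of homomorphisms to `F` as a homomorphism to the shift group. -/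
def homOfFin {A : Type*} [Group A] {N : ℕ} (f : Fin N → (A →* F)) : A →* ShiftGroup F where
  toFun a := ((1 : finSuppSeq F), fun n => if hn : n < N then f ⟨n, hn⟩ a else 1)
  map_one' := Prod.ext rfl (funext fun n => by
    change (if hn : n < N then f ⟨n, hn⟩ 1 else 1) = 1
    split <;> simp)
  map_mul' a b := Prod.ext (mul_one (1 : finSuppSeq F)).symm (funext fun n => by
    change (if hn : n < N then f ⟨n, hn⟩ (a * b) else 1) =
      (if hn : n < N then f ⟨n, hn⟩ a else 1) * (if hn : n < N then f ⟨n, hn⟩ b else 1)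
    split <;> simp)

theorem entry_homOfFin_of_neg {A : Type*} [Group A] {N : ℕ} (f : Fin N → (A →* F)) (a : A)
    {n : ℤ} (hn : n < 0) : (homOfFin f a).entry n = 1 := by
  obtain ⟨k, rfl⟩ := Int.eq_negSucc_of_lt_zero hn
  rfl

theorem entry_homOfFin {A : Type*} [Group A] {N : ℕ} (f : Fin N → (A →* F)) (a : A)
    (i : Fin N) : (homOfFin f a).entry (i : ℕ) = f i a := by
  change (if hn : (i : ℕ) < N then f ⟨i, hn⟩ a else 1) = f i a
  simp

/-- Place an `N`-tuple of homomorphisms at positions `0, …, N - 1`, apply `φ`, and read the `N + c +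
d` entries at positions `-c, …, N + d - 1`. This window determines the tuple. -/
theorem card_hom_le_of_iso [Finite F] [Finite F']
    (h : ContractionGroupIso (shift F) (shift F')) (A : Type*) [Group A] [Finite A] :
    Nat.card (A →* F) ≤ Nat.card (A →* F') := by
  obtain ⟨φ, hφ⟩ := h
  have hφ' (y : ShiftGroup F') : φ.symm (shift F' y) = shift F (φ.symm y) := by
    rw [← φ.symm_apply_apply (shift F (φ.symm y)), hφ, φ.apply_symm_apply]
  obtain ⟨c, hc⟩ := exists_entry_map_eq_one (φ := φ.toMonoidHom) φ.continuous hφ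
  obtain ⟨d, hd⟩ := exists_entry_map_eq_one (φ := φ.symm.toMonoidHom) φ.symm.continuous hφ'
  have : Finite (A →* F) := DFunLike.finite _
  have : Finite (A →* F') := DFunLike.finite _
  refine le_of_forall_pow_le_pow_add (e := c + d) Nat.card_pos fun N => ?_
  have hcard (S : Type _) (k : ℕ) : Nat.card S ^ k = Nat.card (Fin k → S) := by
    simp [Nat.card_fun]
  have hcard' (S : Type _) (k : ℕ) : Nat.card S ^ k = Nat.card (Fin k → S) := by
    simp [Nat.card_fun]
  rw [hcard, hcard']
  refine Nat.card_le_card_of_injective (fun f i =>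
    (entryHom F' ((i : ℕ) - c : ℤ)).comp (φ.toMonoidHom.comp (homOfFin f))) ?_
  intro f g hfg
  ext i a
  set z := homOfFin f a / homOfFin g a with hz
  have hz0 : ∀ n < 0, z.entry n = 1 := fun n hn => by
    rw [hz, entry_div, entry_homOfFin_of_neg f a hn, entry_homOfFin_of_neg g a hn, div_one]
  -- Below `-c` this is the displacement bound for `φ`; from there to `N + d` it is equality of the
  -- windows. The bound `d` for `φ.symm` then kills all entries of `z` below `N`.
  have h1 : ∀ n < (N + d : ℤ), (φ z).entry n = 1 := by
    intro n hn
    rcases lt_or_ge n (0 - c) with hlt | hge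
    · exact hc 0 z hz0 n hlt
    · have h2 := DFunLike.congr_fun (congrFun hfg ⟨(n + c).toNat, by omega⟩) a
      have h3 : (((n + c).toNat : ℕ) : ℤ) - c = n := by omega
      simp only [MonoidHom.comp_apply, entryHom_apply, h3] at h2
      rw [hz, map_div, entry_div]
      exact div_eq_one.mpr h2
  have h4 := hd _ _ h1 (i : ℕ) (by omega)
  have h5 : φ.symm.toMonoidHom (φ z) = z := φ.symm_apply_apply z
  rw [h5, hz, entry_div, entry_homOfFin, entry_homOfFin, div_eq_one] at h4
  exact h4

end Uniqueness

end ShiftGroup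

theorem ContractionGroupIso.symm {G : Type u} {H : Type v} [Group G] [TopologicalSpace G]
    [Group H] [TopologicalSpace H] {α : G ≃ₜ* G} {β : H ≃ₜ* H} (h : ContractionGroupIso α β) :
    ContractionGroupIso β α := by
  obtain ⟨φ, hφ⟩ := h
  refine ⟨φ.symm, fun y => ?_⟩
  rw [← φ.symm_apply_apply (α (φ.symm y)), hφ, φ.apply_symm_apply]

theorem ContractionGroupIso.trans {G : Type u} {H : Type v} {K : Type w} [Group G]
    [TopologicalSpace G] [Group H] [TopologicalSpace H] [Group K] [TopologicalSpace K]
    {α : G ≃ₜ* G} {β : H ≃ₜ* H} {γ : K ≃ₜ* K} (h : ContractionGroupIso α β)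
    (h' : ContractionGroupIso β γ) : ContractionGroupIso α γ := by
  obtain ⟨φ, hφ⟩ := h
  obtain ⟨ψ, hψ⟩ := h'
  refine ⟨φ.trans ψ, fun x => ?_⟩
  change ψ (φ (α x)) = γ (ψ (φ x))
  rw [hφ, hψ]

theorem ShiftGroup.nonempty_mulEquiv_of_iso {F : Type v} {F' : Type w} [CommGroup F] [Finite F]
    [CommGroup F'] [Finite F'] (h : ContractionGroupIso (shift F) (shift F')) :
    Nonempty (F ≃* F') :=
  nonempty_mulEquiv_of_card_hom_eq
    (fun A => le_antisymm (card_hom_le_of_iso h A) (card_hom_le_of_iso h.symm A))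
    (fun A => le_antisymm (card_hom_le_of_iso h A) (card_hom_le_of_iso h.symm A))

/-- Contraction groups are stable under isomorphism. -/
theorem IsTDLCContractionGroup.of_iso {G : Type u} {H : Type v} [Group G] [TopologicalSpace G]
    [Group H] [TopologicalSpace H] {α : G ≃ₜ* G} {β : H ≃ₜ* H}
    (hβ : IsTDLCContractionGroup H β) (h : ContractionGroupIso α β) :
    IsTDLCContractionGroup G α := by
  obtain ⟨φ, hφ⟩ := h
  obtain ⟨h1, h2, h3, h4, h5⟩ := hβ
  refine ⟨?_, φ.toHomeomorph.symm.t2Space, φ.toHomeomorph.isClosedEmbedding.locallyCompactSpace,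
    φ.toHomeomorph.symm.totallyDisconnectedSpace, fun x => ?_⟩
  · exact φ.toHomeomorph.isInducing.topologicalGroup φ.toMulEquiv
  · have hit (n : ℕ) : φ.symm ((⇑β)^[n] (φ x)) = (⇑α)^[n] x := by
      rw [← (Function.Semiconj.iterate_right (f := φ) (ga := α) (gb := β) hφ n) x]
      exact φ.symm_apply_apply _
    have h := (φ.symm.continuous.tendsto 1).comp (h5 (φ x))
    rw [show φ.symm.toHomeomorph 1 = 1 from map_one φ.symm] at h
    exact h.congr hit

/-! ### Shift groups are torsion contraction groups. -/

namespace ShiftGroup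

section Converse

variable (F : Type v) [Group F]

theorem isTopologicalGroup : IsTopologicalGroup (ShiftGroup F) := by
  let _ : TopologicalSpace F := ⊥
  let _ : TopologicalSpace (finSuppSeq F) := ⊥
  have : DiscreteTopology F := ⟨rfl⟩
  have : DiscreteTopology (finSuppSeq F) := ⟨rfl⟩
  exact (inferInstance : IsTopologicalGroup (finSuppSeq F × (ℕ → F)))

/-- Countable times compact; needed for the open mapping theorem. -/
theorem sigmaCompactSpace [Finite F] : SigmaCompactSpace (ShiftGroup F) := by
  let _ : TopologicalSpace F := ⊥
  let _ : TopologicalSpace (finSuppSeq F) := ⊥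
  have : DiscreteTopology F := ⟨rfl⟩
  have : DiscreteTopology (finSuppSeq F) := ⟨rfl⟩
  have : Countable (finSuppSeq F) := by
    refine Function.Injective.countable
      (f := fun x : finSuppSeq F => (Finsupp.ofSupportFinite (fun n => Additive.ofMul (x.1 n)) x.2))
      fun x y h => Subtype.ext (funext fun n => ?_)
    exact DFunLike.congr_fun h n
  exact (inferInstance : SigmaCompactSpace (finSuppSeq F × (ℕ → F)))

theorem isTDLCContractionGroup [Finite F] : IsTDLCContractionGroup (ShiftGroup F) (shift F) := by
  refine ⟨isTopologicalGroup F, ?_, ?_, ?_, fun x => ?_⟩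
  iterate 3
    let _ : TopologicalSpace F := ⊥
    let _ : TopologicalSpace (finSuppSeq F) := ⊥
    have : DiscreteTopology F := ⟨rfl⟩
    have : DiscreteTopology (finSuppSeq F) := ⟨rfl⟩
    first
    | exact (inferInstance : T2Space (finSuppSeq F × (ℕ → F)))
    | exact (inferInstance : LocallyCompactSpace (finSuppSeq F × (ℕ → F)))
    | exact (inferInstance : TotallyDisconnectedSpace (finSuppSeq F × (ℕ → F)))
  · intro U hU
    obtain ⟨N, hN⟩ := mem_nhds_one_iff.mp hU
    obtain ⟨K, hK⟩ := exists_entry_eq_one x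
    -- After `n` shifts all entries below `K + n` are trivial.
    refine Filter.mem_atTop_sets.mpr ⟨(N - K).toNat, fun n hn => hN _ fun k hk => ?_⟩
    have h1 : (⇑(shift F))^[n] x = (shiftAut F ^ (n : ℤ)) x := by
      rw [zpow_natCast, ← MulAut.iterate_eq_pow]
      rfl
    change ((⇑(shift F))^[n] x).entry k = 1
    rw [h1, entry_shiftAut_zpow]
    exact hK _ (by omega)

theorem isMulTorsion [Finite F] : IsMulTorsion (ShiftGroup F) := fun x => by
  refine isOfFinOrder_iff_pow_eq_one.mpr ⟨Nat.card F, Nat.card_pos, ext_entry fun n => ?_⟩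
  have := map_pow (entryHom F n) x (Nat.card F)
  rw [entryHom_apply, entryHom_apply] at this
  rw [this, pow_card_eq_one', entry_one]

end Converse

end ShiftGroup

/-- A compact open subgroup `V` which is contracted to `0` by the powers of the automorphism `a`,
and whose translates under the negative powers of `a` exhaust the group. -/
structure IsContractingLattice {M : Type*} [AddCommGroup M] [TopologicalSpace M]
    (a : M ≃ₗ[ℤ] M) (V : AddSubgroup M) : Prop where
  continuous_zpow : ∀ n : ℤ, Continuous ⇑(a ^ n)
  isOpen : IsOpen (V : Set M)
  isCompact : IsCompact (V : Set M)
  map_mem : ∀ x ∈ V, a x ∈ V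
  exists_pow_mem : ∀ x, ∃ n : ℕ, (a ^ n) x ∈ V
  exists_pow_subset : ∀ U ∈ 𝓝 (0 : M), ∃ n : ℕ, ∀ x ∈ V, (a ^ n) x ∈ U

/-! ### Existence of a contracting lattice. -/

section Existence

variable {M : Type*} [AddCommGroup M] [TopologicalSpace M] [IsTopologicalAddGroup M] [T2Space M]
  [LocallyCompactSpace M]

/-- Compact open subgroups form a basis of neighbourhoods of `0` in a totally disconnected
locally compact group. -/
theorem exists_isCompact_isOpen_addSubgroup [TotallyDisconnectedSpace M] {U : Set M}
    (hU : U ∈ 𝓝 0) :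
    ∃ K : AddSubgroup M, IsOpen (K : Set M) ∧ IsCompact (K : Set M) ∧ (K : Set M) ⊆ U := by
  obtain ⟨N, hN, hNU, hNc⟩ := local_compact_nhds hU
  obtain ⟨C, hC, h0, hCN⟩ := (loc_compact_Haus_tot_disc_of_zero_dim (H := M)).mem_nhds_iff.mp hN
  have hCc : IsCompact C := hNc.of_isClosed_subset hC.isClosed hCN
  obtain ⟨T, hT, hTC⟩ := compact_open_separated_add_left hCc hC.isOpen subset_rfl
  -- The stabiliser of `C` under translation: inside `C` since `0 ∈ C`, and open since `C` is
  -- compact and open.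
  let K : AddSubgroup M :=
    { carrier := {g | ∀ c ∈ C, g + c ∈ C ∧ -g + c ∈ C}
      zero_mem' := fun c hc => by simpa using hc
      add_mem' := fun {g h} hg hh c hc => by
        refine ⟨?_, ?_⟩
        · rw [add_assoc]
          exact (hg _ (hh c hc).1).1
        · rw [neg_add, add_assoc]
          exact (hg _ (hh c hc).2).2
      neg_mem' := fun {g} hg c hc => ⟨(hg c hc).2, by simpa using (hg c hc).1⟩ }
  have hKC : (K : Set M) ⊆ C := fun g hg => by simpa using (hg 0 h0).1
  have hKo : IsOpen (K : Set M) := by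
    refine AddSubgroup.isOpen_of_mem_nhds K (g := 0) ?_
    filter_upwards [hT, neg_mem_nhds_zero M hT] with g hg hg' c hc
    exact ⟨hTC (Set.add_mem_add hg hc), hTC (Set.add_mem_add hg' hc)⟩
  exact ⟨K, hKo, hCc.of_isClosed_subset (K.isClosed_of_isOpen hKo) hKC, (hKC.trans hCN).trans hNU⟩

/-- The points whose orbit stays in `K` from time `n` on form closed subgroups `W n`, which cover
`M` by contractivity. By Baire some `W n` is open, hence so is `W 0 = a ^ n (W n)`, which is
`a`-stable and lies in `K`. -/
theorem exists_isCompact_isOpen_map_mem [TotallyDisconnectedSpace M] {a : M ≃ₗ[ℤ] M}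
    (hcont : ∀ n : ℤ, Continuous ⇑(a ^ n))
    (ha : ∀ x, Tendsto (fun n : ℕ => (a ^ n) x) atTop (𝓝 0)) {U : Set M} (hU : U ∈ 𝓝 0) :
    ∃ V : AddSubgroup M, IsOpen (V : Set M) ∧ IsCompact (V : Set M) ∧ (V : Set M) ⊆ U ∧
      ∀ x ∈ V, a x ∈ V := by
  obtain ⟨K, hKo, hKc, hKU⟩ := exists_isCompact_isOpen_addSubgroup hU
  have hcont' (n : ℕ) : Continuous ⇑(a ^ n) := by simpa using hcont n
  have hKcl : IsClosed (K : Set M) := K.isClosed_of_isOpen hKo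
  let W (n : ℕ) : AddSubgroup M :=
    ⨅ k : {k : ℕ // n ≤ k}, K.comap ((a ^ (k : ℕ)).toLinearMap.toAddMonoidHom)
  have hW (n : ℕ) (x : M) : x ∈ W n ↔ ∀ k, n ≤ k → (a ^ k) x ∈ K := by
    simp [W, AddSubgroup.mem_iInf]
  have hWcl (n : ℕ) : IsClosed (W n : Set M) := by
    have : (W n : Set M) = ⋂ (k : ℕ) (_ : n ≤ k), ⇑(a ^ k) ⁻¹' K := by
      ext x
      simp [hW]
    rw [this]
    exact isClosed_iInter fun k => isClosed_iInter fun _ => hKcl.preimage (hcont' k)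
  obtain ⟨n, x, hx⟩ := nonempty_interior_of_iUnion_of_closed hWcl (by
    refine Set.eq_univ_of_forall fun x => Set.mem_iUnion.mpr ?_
    obtain ⟨n, hn⟩ := mem_atTop_sets.mp (ha x (hKo.mem_nhds K.zero_mem))
    exact ⟨n, (hW n x).mpr hn⟩)
  have hWo : IsOpen (W n : Set M) :=
    AddSubgroup.isOpen_of_mem_nhds _ (mem_interior_iff_mem_nhds.mp hx)
  have hW0 : IsOpen (W 0 : Set M) := by
    refine AddSubgroup.isOpen_of_mem_nhds _ (g := 0) ?_
    have h1 : ⇑(a ^ (-(n : ℤ))) ⁻¹' (W n) ∈ 𝓝 0 :=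
      (hWo.preimage (hcont _)).mem_nhds (by simp)
    filter_upwards [h1] with y hy
    refine (hW 0 y).mpr fun k _ => ?_
    have h2 := (hW n _).mp hy (n + k) (by omega)
    rwa [← LinearEquiv.mul_apply, ← zpow_natCast a (n + k), ← zpow_add, Nat.cast_add,
      add_neg_cancel_comm, zpow_natCast] at h2
  have hWK : (W 0 : Set M) ⊆ K := fun y hy => by simpa using (hW 0 y).mp hy 0 le_rfl
  refine ⟨W 0, hW0, hKc.of_isClosed_subset (hWcl 0) hWK, hWK.trans hKU, fun y hy => ?_⟩
  refine (hW 0 _).mpr fun k _ => ?_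
  rw [← LinearEquiv.mul_apply, ← pow_succ]
  exact (hW 0 y).mp hy (k + 1) (Nat.zero_le _)

/-- A totally disconnected locally compact abelian contraction group contains a contracting
lattice. -/
theorem exists_isContractingLattice [TotallyDisconnectedSpace M] {a : M ≃ₗ[ℤ] M}
    (hcont : ∀ n : ℤ, Continuous ⇑(a ^ n))
    (ha : ∀ x, Tendsto (fun n : ℕ => (a ^ n) x) atTop (𝓝 0)) :
    ∃ V, IsContractingLattice a V := by
  obtain ⟨V, hVo, hVc, -, hVa⟩ := exists_isCompact_isOpen_map_mem hcont ha univ_mem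
  refine ⟨V, hcont, hVo, hVc, hVa, fun x => ?_, fun U hU => ?_⟩
  · obtain ⟨n, hn⟩ := mem_atTop_sets.mp (ha x (hVo.mem_nhds V.zero_mem))
    exact ⟨n, hn n le_rfl⟩
  -- Uniform contraction: for an `a`-stable `V'` the open sets `a ^ (-n) (V')` increase and cover
  -- the compact `V`.
  · obtain ⟨V', hVo', -, hVU', hVa'⟩ := exists_isCompact_isOpen_map_mem hcont ha hU
    have hmono : Monotone fun n : ℕ => ⇑(a ^ n) ⁻¹' (V' : Set M) :=
      monotone_nat_of_le_succ fun n x hx => by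
        change (a ^ (n + 1)) x ∈ V'
        rw [pow_succ', LinearEquiv.mul_apply]
        exact hVa' _ hx
    obtain ⟨n, hn⟩ := hVc.elim_directed_cover (fun n : ℕ => ⇑(a ^ n) ⁻¹' (V' : Set M))
      (fun n => hVo'.preimage (by simpa using hcont n))
      (fun x _ => by
        obtain ⟨n, hn⟩ := mem_atTop_sets.mp (ha x (hVo'.mem_nhds V'.zero_mem))
        exact Set.mem_iUnion.mpr ⟨n, hn n le_rfl⟩)
      hmono.directed_le
    exact ⟨n, fun x hx => hVU' (hn hx)⟩

end Existence

/-! ### The filtration and summability. -/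

namespace IsContractingLattice

variable {M : Type*} [AddCommGroup M] {a : M ≃ₗ[ℤ] M} {V : AddSubgroup M}

/-- The filtration `n ↦ a ^ n (V)`. -/
def filtration (a : M ≃ₗ[ℤ] M) (V : AddSubgroup M) (n : ℤ) : AddSubgroup M :=
  V.comap ((a ^ (-n)).toLinearMap.toAddMonoidHom)

theorem mem_filtration {n : ℤ} {x : M} : x ∈ filtration a V n ↔ (a ^ (-n)) x ∈ V := Iff.rfl

theorem filtration_zero : filtration a V 0 = V := by
  ext x
  simp [mem_filtration]

theorem zpow_mem_filtration {n k : ℤ} {x : M} :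
    (a ^ k) x ∈ filtration a V n ↔ x ∈ filtration a V (n - k) := by
  rw [mem_filtration, mem_filtration, ← LinearEquiv.mul_apply, ← zpow_add, neg_sub,
    neg_add_eq_sub]

variable [TopologicalSpace M]

theorem filtration_antitone (hV : IsContractingLattice a V) : Antitone (filtration a V) := by
  refine antitone_int_of_succ_le fun n x hx => ?_
  have h := hV.map_mem _ hx
  rw [mem_filtration]
  have h' : (a ^ (-n)) x = a ((a ^ (-(n + 1))) x) := by
    rw [← LinearEquiv.mul_apply, ← zpow_one_add]
    congr 2; ring
  rw [h']
  exact h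

theorem isOpen_filtration (hV : IsContractingLattice a V)
    (n : ℤ) : IsOpen (filtration a V n : Set M) :=
  hV.isOpen.preimage (hV.continuous_zpow (-n))

theorem exists_mem_filtration (hV : IsContractingLattice a V)
    (x : M) : ∃ n : ℤ, x ∈ filtration a V n := by
  obtain ⟨n, hn⟩ := hV.exists_pow_mem x
  exact ⟨-n, by simpa [mem_filtration] using hn⟩

theorem exists_filtration_subset (hV : IsContractingLattice a V) {U : Set M} (hU : U ∈ 𝓝 0) :
    ∃ n : ℤ, (filtration a V n : Set M) ⊆ U := by
  obtain ⟨n, hn⟩ := hV.exists_pow_subset U hU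
  refine ⟨n, fun x hx => ?_⟩
  have : (a ^ n) ((a ^ (-(n : ℤ))) x) ∈ U := hn _ hx
  rwa [← LinearEquiv.mul_apply, ← zpow_natCast, ← zpow_add, add_neg_cancel, zpow_zero] at this

variable [IsTopologicalAddGroup M]

theorem isClosed_filtration (hV : IsContractingLattice a V)
    (n : ℤ) : IsClosed (filtration a V n : Set M) :=
  AddSubgroup.isClosed_of_isOpen _ (hV.isOpen_filtration n)

theorem nonarchimedeanAddGroup (hV : IsContractingLattice a V) : NonarchimedeanAddGroup M where
  is_nonarchimedean U hU := by
    obtain ⟨n, hn⟩ := hV.exists_filtration_subset hU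
    exact ⟨⟨filtration a V n, hV.isOpen_filtration n⟩, hn⟩

theorem tsum_mem_filtration (hV : IsContractingLattice a V) {ι : Type*} {n : ℤ} {g : ι → M}
    (hg : ∀ i, g i ∈ filtration a V n) :
    ∑' i, g i ∈ filtration a V n := by
  by_cases h : Summable g
  · exact (hV.isClosed_filtration n).mem_of_tendsto h.hasSum
      (Eventually.of_forall fun s => sum_mem fun i _ => hg i)
  · rw [tsum_eq_zero_of_not_summable h]
    exact zero_mem _

/-- A family whose members lie deeper and deeper in the filtration is summable. -/
theorem summable_of_mem_filtration (hV : IsContractingLattice a V) [LocallyCompactSpace M]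
    {ι : Type*} {g : ι → M} {d : ι → ℤ} (hd : ∀ i, g i ∈ filtration a V (d i))
    (hfin : ∀ N : ℤ, {i | d i < N ∧ g i ≠ 0}.Finite) : Summable g := by
  -- Local compactness gives completeness; in a complete nonarchimedean group, families tending to
  -- zero are summable.
  let _ : UniformSpace M := IsTopologicalAddGroup.rightUniformSpace M
  have : IsUniformAddGroup M := isUniformAddGroup_of_addCommGroup
  have : CompleteSpace M :=
    IsRightUniformAddGroup.completeSpace_of_weaklyLocallyCompactSpace
  have := hV.nonarchimedeanAddGroup
  refine NonarchimedeanAddGroup.summable_of_tendsto_cofinite_zero fun U hU => ?_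
  obtain ⟨N, hN⟩ := hV.exists_filtration_subset hU
  refine (hfin N).subset fun i hi => ?_
  refine ⟨?_, fun h0 => hi ?_⟩
  · by_contra! h
    exact hi (hN (hV.filtration_antitone h (hd i)))
  · change g i ∈ U
    rw [h0]
    exact mem_of_mem_nhds hU

end IsContractingLattice

theorem LaurentSeries.exists_coeff_eq_zero {R : Type*} [Zero R] (f : LaurentSeries R) :
    ∃ N : ℤ, ∀ n < N, f.coeff n = 0 :=
  ⟨f.order, fun _ hn => HahnSeries.coeff_eq_zero_of_lt_order hn⟩

/-- Puts the finite convolution into the form met when a double series is summed along diagonals. -/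
theorem LaurentSeries.hasSum_coeff_mul_smul {R M : Type*} [CommRing R] [AddCommGroup M]
    [Module R M] [TopologicalSpace M] (f g : LaurentSeries R) (n : ℤ) (y : M) :
    HasSum (fun i => (f.coeff i * g.coeff (n - i)) • y) ((f * g).coeff n • y) := by
  rw [HahnSeries.coeff_mul, Finset.sum_smul]
  set s := Finset.antidiagonal f.isPWO_support g.isPWO_support n
  have hs : ∑ p ∈ s, (f.coeff p.1 * g.coeff p.2) • y =
      ∑ i ∈ s.image Prod.fst, (f.coeff i * g.coeff (n - i)) • y := by
    rw [Finset.sum_image]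
    · refine Finset.sum_congr rfl fun p hp => ?_
      rw [← (Finset.mem_antidiagonal.mp hp).2.2, add_sub_cancel_left]
    · intro p hp q hq hpq
      have h1 := (Finset.mem_antidiagonal.mp hp).2.2
      have h2 := (Finset.mem_antidiagonal.mp hq).2.2
      exact Prod.ext hpq (by omega)
  rw [hs]
  refine hasSum_sum_of_ne_finset_zero fun i hi => ?_
  by_contra hne
  refine hi (Finset.mem_image.mpr ⟨(i, n - i), Finset.mem_antidiagonal.mpr ⟨?_, ?_, ?_⟩, rfl⟩)
  · exact fun h0 => hne (by rw [h0, zero_mul, zero_smul])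
  · exact fun h0 => hne (by rw [h0, mul_zero, zero_smul])
  · simp

/-! ### The Laurent series module. -/

namespace IsContractingLattice

variable {M : Type*} [AddCommGroup M] [TopologicalSpace M] [IsTopologicalAddGroup M]
  {a : M ≃ₗ[ℤ] M} {V : AddSubgroup M}

/-- Finitely many elements of a contracting lattice serve as digits. -/
theorem exists_finset_digits (hV : IsContractingLattice a V) :
    ∃ T : Finset M, (∀ t ∈ T, t ∈ V) ∧ ∀ x ∈ V, ∃ t ∈ T, x - t ∈ filtration a V 1 := by
  have hcover := hV.isCompact.elim_nhds_subcover' (fun x _ => {y | y - x ∈ filtration a V 1})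
    fun x _ => by
      refine ((hV.isOpen_filtration 1).preimage (continuous_id.sub continuous_const)).mem_nhds ?_
      simp
  obtain ⟨T, hT⟩ := hcover
  classical
  refine ⟨T.image Subtype.val, fun t ht => ?_, fun x hx => ?_⟩
  · obtain ⟨s, -, rfl⟩ := Finset.mem_image.mp ht
    exact s.2
  · obtain ⟨t, ht, hxt⟩ := Set.mem_iUnion₂.mp (hT hx)
    exact ⟨t, Finset.mem_image_of_mem _ ht, hxt⟩

variable [LocallyCompactSpace M]

/-- If `y n` vanishes for small `n` and stays in one step of the filtration, then
`∑ n, a ^ n (y n)` converges. -/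
theorem summable_zpow_apply (hV : IsContractingLattice a V) {y : ℤ → M} {N k : ℤ}
    (hy : ∀ n < N, y n = 0) (hk : ∀ n, y n ∈ filtration a V k) :
    Summable fun n : ℤ => (a ^ n) (y n) := by
  refine hV.summable_of_mem_filtration (d := fun n => k + n)
    (fun n => zpow_mem_filtration.mpr (by simpa using hk n)) fun K => ?_
  refine (Set.finite_Ico N (K - k)).subset fun n hn => ⟨?_, by linarith [hn.1]⟩
  by_contra! h
  exact hn.2 (by rw [hy n h, map_zero])

theorem summable_coeff_smul (hV : IsContractingLattice a V) (f : LaurentSeries ℤ) (x : M) :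
    Summable fun n : ℤ => f.coeff n • (a ^ n) x := by
  obtain ⟨N, hN⟩ := f.exists_coeff_eq_zero
  obtain ⟨k, hk⟩ := hV.exists_mem_filtration x
  simp_rw [← map_zsmul]
  exact hV.summable_zpow_apply (N := N) (k := k) (fun n hn => by rw [hN n hn, zero_smul])
    fun n => zsmul_mem hk _

theorem summable_coeff_mul_coeff_smul (hV : IsContractingLattice a V) (f g : LaurentSeries ℤ)
    (x : M) :
    Summable fun p : ℤ × ℤ => (f.coeff p.1 * g.coeff p.2) • (a ^ (p.1 + p.2)) x := by
  obtain ⟨A, hA⟩ := f.exists_coeff_eq_zero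
  obtain ⟨B, hB⟩ := g.exists_coeff_eq_zero
  obtain ⟨k, hk⟩ := hV.exists_mem_filtration x
  refine hV.summable_of_mem_filtration (d := fun p => k + (p.1 + p.2))
    (fun p => zsmul_mem (zpow_mem_filtration.mpr (by simpa using hk)) _) fun K => ?_
  -- With `i ≥ A` and `j ≥ B`, an upper bound on `i + j` confines both indices.
  refine ((Set.finite_Ico A (K - k - B)).prod (Set.finite_Ico B (K - k - A))).subset ?_
  rintro ⟨i, j⟩ ⟨h1, h2⟩
  have hi : A ≤ i := by
    by_contra! hi
    exact h2 (by simp [hA i hi])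
  have hj : B ≤ j := by
    by_contra! hj
    exact h2 (by simp [hB j hj])
  simp only [Set.mem_prod, Set.mem_Ico]
  simp only at h1
  omega

/-- The action of a Laurent series, the variable acting as the automorphism `a`. -/
noncomputable def laurentSMul (a : M ≃ₗ[ℤ] M) (f : LaurentSeries ℤ) (x : M) : M :=
  ∑' n : ℤ, f.coeff n • (a ^ n) x

variable [T2Space M]

theorem laurentSMul_laurentSMul (hV : IsContractingLattice a V) (f g : LaurentSeries ℤ) (x : M) :
    laurentSMul a f (laurentSMul a g x) =
      ∑' p : ℤ × ℤ, (f.coeff p.1 * g.coeff p.2) • (a ^ (p.1 + p.2)) x := by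
  have hrow (i : ℤ) : HasSum (fun j => (f.coeff i * g.coeff j) • (a ^ (i + j)) x)
      (f.coeff i • (a ^ i) (laurentSMul a g x)) := by
    have h1 := ((hV.summable_coeff_smul g x).hasSum.map (a ^ i) (hV.continuous_zpow i)).const_smul
      (f.coeff i)
    refine h1.congr_fun fun j => ?_
    simp only [Function.comp_apply, map_zsmul, ← LinearEquiv.mul_apply, ← zpow_add, smul_smul]
  rw [(hV.summable_coeff_mul_coeff_smul f g x).tsum_prod' fun i => (hrow i).summable]
  exact tsum_congr fun i => (hrow i).tsum_eq.symm

theorem laurentSMul_mul (hV : IsContractingLattice a V) (f g : LaurentSeries ℤ) (x : M) :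
    laurentSMul a (f * g) x = laurentSMul a f (laurentSMul a g x) := by
  -- Sends (total degree `n`, first index `i`) to `(i, n - i)`.
  let e : ℤ × ℤ ≃ ℤ × ℤ :=
    ⟨fun p => (p.2, p.1 - p.2), fun p => (p.1 + p.2, p.1), fun p => by simp, fun p => by simp⟩
  have hsum := hV.summable_coeff_mul_coeff_smul f g x
  rw [hV.laurentSMul_laurentSMul, ← e.tsum_eq]
  have h0 (p : ℤ × ℤ) : (f.coeff (e p).1 * g.coeff (e p).2) • (a ^ ((e p).1 + (e p).2)) x =
      (f.coeff p.2 * g.coeff (p.1 - p.2)) • (a ^ p.1) x := by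
    simp [e]
  rw [← e.summable_iff] at hsum
  have hsum' := hsum.congr h0
  rw [tsum_congr h0, hsum'.tsum_prod' fun n =>
    (LaurentSeries.hasSum_coeff_mul_smul f g n ((a ^ n) x)).summable]
  exact tsum_congr fun n => (LaurentSeries.hasSum_coeff_mul_smul f g n ((a ^ n) x)).tsum_eq.symm

/-- The module structure over integral Laurent series, the variable acting as `a`. -/
noncomputable abbrev laurentModule (hV : IsContractingLattice a V) :
    Module (LaurentSeries ℤ) M where
  smul := laurentSMul a
  one_smul x := by
    change ∑' n : ℤ, _ = x
    rw [tsum_eq_single 0 fun n hn => by simp [HahnSeries.coeff_one, hn]]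
    simp
  mul_smul := hV.laurentSMul_mul
  smul_zero f := by
    change ∑' n : ℤ, _ = _
    simp
  smul_add f x y := by
    change ∑' n : ℤ, _ = laurentSMul a f x + laurentSMul a f y
    rw [laurentSMul, laurentSMul,
      ← (hV.summable_coeff_smul f x).tsum_add (hV.summable_coeff_smul f y)]
    simp only [map_add, smul_add]
  add_smul f g x := by
    change ∑' n : ℤ, _ = laurentSMul a f x + laurentSMul a g x
    rw [laurentSMul, laurentSMul,
      ← (hV.summable_coeff_smul f x).tsum_add (hV.summable_coeff_smul g x)]
    simp only [HahnSeries.coeff_add, add_smul]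
  zero_smul x := by
    change ∑' n : ℤ, _ = _
    simp

theorem laurentModule_smul_def (hV : IsContractingLattice a V) (f : LaurentSeries ℤ) (x : M) :
    letI := hV.laurentModule
    f • x = ∑' n : ℤ, f.coeff n • (a ^ n) x := rfl

theorem laurentModule_single_one_smul (hV : IsContractingLattice a V) (n : ℤ) (x : M) :
    letI := hV.laurentModule
    (HahnSeries.single n (1 : ℤ) : LaurentSeries ℤ) • x = (a ^ n) x := by
  rw [laurentModule_smul_def, tsum_eq_single n fun k hk => by
    simp [HahnSeries.coeff_single_of_ne hk]]
  simp

/-- Every element of a contracting lattice has an expansion with digits in `T`. -/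
theorem exists_digit_expansion (hV : IsContractingLattice a V) {T : Finset M}
    (hTV : ∀ t ∈ T, t ∈ V) (hT : ∀ x ∈ V, ∃ t ∈ T, x - t ∈ filtration a V 1) {x : M} (hx : x ∈ V) :
    ∃ d : ℕ → M, (∀ n, d n ∈ T) ∧ HasSum (fun n : ℕ => (a ^ (n : ℤ)) (d n)) x := by
  choose! t ht hxt using hT
  -- Remainders, with `x = ∑_{i < n} a ^ i (t (r i)) + a ^ n (r n)`; they stay in `V` because `r n -
  -- t (r n)` lies in `a V`.
  let r : ℕ → M := fun n => Nat.rec x (fun _ y => (a ^ (-1 : ℤ)) (y - t y)) n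
  have hr (n : ℕ) : r n ∈ V := by
    induction n with
    | zero => exact hx
    | succ n ih => exact hxt _ ih
  refine ⟨fun n => t (r n), fun n => ht _ (hr n), ?_⟩
  have key (n : ℕ) : x - ∑ i ∈ Finset.range n, (a ^ (i : ℤ)) (t (r i)) = (a ^ (n : ℤ)) (r n) := by
    induction n with
    | zero => simp [r]
    | succ n ih =>
      have h1 : r (n + 1) = (a ^ (-1 : ℤ)) (r n - t (r n)) := rfl
      rw [Finset.sum_range_succ, ← sub_sub, ih, h1, ← map_sub, ← LinearEquiv.mul_apply, ← zpow_add]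
      congr 2
      push_cast
      ring
  have hsum : Summable fun n : ℕ => (a ^ (n : ℤ)) (t (r n)) := by
    refine hV.summable_of_mem_filtration (d := fun n => n) (fun n => ?_) fun K => ?_
    · rw [zpow_mem_filtration, sub_self, filtration_zero]
      exact hTV _ (ht _ (hr n))
    · refine (Set.finite_Iio K.toNat).subset fun n hn => ?_
      have := hn.1
      simp only [Set.mem_Iio]
      omega
  have hlim : Tendsto (fun n : ℕ => ∑ i ∈ Finset.range n, (a ^ (i : ℤ)) (t (r i))) atTop
      (𝓝 x) := by
    have h0 : Tendsto (fun n : ℕ => (a ^ (n : ℤ)) (r n)) atTop (𝓝 0) := fun U hU => by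
      obtain ⟨N, hN⟩ := hV.exists_filtration_subset hU
      refine mem_atTop_sets.mpr ⟨N.toNat, fun n hn => hN ?_⟩
      refine hV.filtration_antitone (show N ≤ n by omega) ?_
      rw [zpow_mem_filtration, sub_self, filtration_zero]
      exact hr n
    have h1 := (tendsto_const_nhds (x := x)).sub h0
    rw [sub_zero] at h1
    exact h1.congr fun n => by rw [← key n, sub_sub_cancel]
  exact (tendsto_nhds_unique hsum.hasSum.tendsto_sum_nat hlim) ▸ hsum.hasSum

/-- The digits generate: collecting equal digits in an expansion gives power series coefficients,
and a negative power of the variable reaches elements outside `V`. -/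
theorem laurentModule_finite (hV : IsContractingLattice a V) :
    letI := hV.laurentModule
    Module.Finite (LaurentSeries ℤ) M := by
  classical
  let := hV.laurentModule
  obtain ⟨T, hTV, hT⟩ := hV.exists_finset_digits
  refine ⟨⟨T, eq_top_iff.mpr fun x _ => ?_⟩⟩
  have hspan : ∀ x ∈ V, x ∈ Submodule.span (LaurentSeries ℤ) (T : Set M) := by
    intro x hx
    obtain ⟨d, hdT, hd⟩ := hV.exists_digit_expansion hTV hT hx
    let f (t : M) : LaurentSeries ℤ :=
      HahnSeries.ofPowerSeries ℤ ℤ (PowerSeries.mk fun n => if d n = t then 1 else 0)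
    have hf (t : M) (n : ℤ) (i : ℕ) (hi : n = i) : (f t).coeff n = if d i = t then 1 else 0 := by
      subst hi
      simp [f]
    have hf' (t : M) (n : ℤ) (hn : n < 0) : (f t).coeff n = 0 := by
      simp [f, PowerSeries.coeff_coe, hn]
    suffices hxs : x = ∑ t ∈ T, f t • t by
      rw [hxs]
      exact sum_mem fun t ht => Submodule.smul_mem _ _ (Submodule.subset_span ht)
    have hterm : ∑ t ∈ T, f t • t = ∑' n : ℤ, ∑ t ∈ T, (f t).coeff n • (a ^ n) t :=
      (Summable.tsum_finsetSum fun t _ => hV.summable_coeff_smul (f t) t).symm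
    rw [hterm, ← hd.tsum_eq, ← Function.Injective.tsum_eq (Nat.cast_injective (R := ℤ))]
    · refine tsum_congr fun n => ?_
      simp_rw [hf _ _ n rfl, ite_smul, one_smul, zero_smul]
      rw [Finset.sum_ite_eq T (d n), if_pos (hdT n)]
    · intro n hn
      by_contra h
      refine hn (Finset.sum_eq_zero fun t _ => ?_)
      rw [hf' t n, zero_smul]
      by_contra! hn0
      exact h ⟨n.toNat, Int.toNat_of_nonneg hn0⟩
  obtain ⟨n, hn⟩ := hV.exists_pow_mem x
  have h1 : x = (HahnSeries.single (-n : ℤ) (1 : ℤ) : LaurentSeries ℤ) • (a ^ n) x := by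
    rw [hV.laurentModule_single_one_smul, ← LinearEquiv.mul_apply, ← zpow_natCast, ← zpow_add,
      neg_add_cancel, zpow_zero]
    rfl
  rw [h1]
  exact Submodule.smul_mem _ _ (hspan _ hn)

end IsContractingLattice

/-- The structure theorem for finitely generated modules over the integral Laurent series in which
every element is annihilated by a nonzero integer: they are direct sums of cyclic modules whose
annihilators are generated by nonzero integers. -/
theorem LaurentSeries.exists_basis_of_torsion (M : Type*) [AddCommGroup M]
    [Module (LaurentSeries ℤ) M] [Module.Finite (LaurentSeries ℤ) M]
    (htors : ∀ x : M, ∃ m : ℕ, m ≠ 0 ∧ m • x = 0) :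
    ∃ (ι : Type) (_ : Fintype ι) (q : ι → ℕ) (b : ι → M), (∀ i, q i ≠ 0) ∧
      (∀ i, q i • b i = 0) ∧ (∀ x, ∃ f : ι → LaurentSeries ℤ, x = ∑ i, f i • b i) ∧
      ∀ f : ι → LaurentSeries ℤ, ∑ i, f i • b i = 0 → ∀ i n, (q i : ℤ) ∣ (f i).coeff n := by
  classical
  have := LaurentSeries.isPrincipalIdealRing ℤ
  have hcast {m : ℕ} (hm : m ≠ 0) : (m : LaurentSeries ℤ) ≠ 0 := by
    rw [← Int.cast_natCast, intCast_eq_single]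
    simpa using hm
  have hM : Module.IsTorsion (LaurentSeries ℤ) M := fun {x} => by
    obtain ⟨m, hm, hx⟩ := htors x
    refine ⟨⟨m, mem_nonZeroDivisors_of_ne_zero (hcast hm)⟩, ?_⟩
    change (m : LaurentSeries ℤ) • x = 0
    rw [Nat.cast_smul_eq_nsmul, hx]
  obtain ⟨ι, _, p, -, e, ⟨φ₀⟩⟩ := Module.equiv_directSum_of_isTorsion hM
  let φ := φ₀.trans (DirectSum.linearEquivFunOnFintype (LaurentSeries ℤ) ι _)
  let b (i : ι) : M := φ.symm (Pi.single i (Submodule.Quotient.mk 1))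
  have hφ (f : ι → LaurentSeries ℤ) :
      φ (∑ i, f i • b i) = fun i => Submodule.Quotient.mk (f i) := by
    simp only [map_sum, map_smul, b, LinearEquiv.apply_symm_apply]
    funext j
    rw [Finset.sum_apply, Finset.sum_eq_single j]
    · rw [Pi.smul_apply, Pi.single_eq_same, ← Submodule.Quotient.mk_smul, smul_eq_mul, mul_one]
    · intro i _ hij
      rw [Pi.smul_apply, Pi.single_eq_of_ne hij.symm, smul_zero]
    · simp
  have hzero (f : ι → LaurentSeries ℤ) : ∑ i, f i • b i = 0 ↔ ∀ i, p i ^ e i ∣ f i := by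
    rw [← φ.map_eq_zero_iff, hφ, funext_iff]
    refine forall_congr' fun i => ?_
    rw [Pi.zero_apply, Submodule.Quotient.mk_eq_zero]
    exact Ideal.mem_span_singleton
  have hsmul (i : ι) (m : ℕ) : m • b i = 0 ↔ p i ^ e i ∣ (m : LaurentSeries ℤ) := by
    have h1 : ∑ j, (Pi.single i (m : LaurentSeries ℤ) : ι → LaurentSeries ℤ) j • b j =
        m • b i := by
      rw [Finset.sum_eq_single i, Pi.single_eq_same, Nat.cast_smul_eq_nsmul]
      · intro j _ hj
        rw [Pi.single_eq_of_ne hj, zero_smul]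
      · simp
    rw [← h1, hzero]
    refine ⟨fun h => by simpa using h i, fun h j => ?_⟩
    rcases eq_or_ne j i with rfl | hj
    · simpa using h
    · simp [Pi.single_eq_of_ne hj]
  -- Some nonzero integer kills `b i`, so `p i ^ e i` divides it and is associated to an integer.
  have hq (i : ι) : ∃ q : ℕ, q ≠ 0 ∧ Associated (p i ^ e i) q := by
    obtain ⟨m, hm, hb⟩ := htors (b i)
    exact exists_associated_natCast hm _ ((hsmul i m).mp hb)
  choose q hq0 hqa using hq
  refine ⟨ι, inferInstance, q, b, hq0, fun i => (hsmul i _).mpr (hqa i).dvd, fun x => ?_,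
    fun f hf i n => ?_⟩
  · choose f hf using fun i => Submodule.Quotient.mk_surjective _ (φ x i)
    refine ⟨f, φ.injective ?_⟩
    rw [hφ]
    exact funext fun i => (hf i).symm
  · refine (intCast_dvd_iff _ _).mp ?_ n
    rw [Int.cast_natCast]
    exact (hqa i).symm.dvd.trans ((hzero f).mp hf i)

/-! ### Comparison with a shift group. -/

namespace IsContractingLattice

variable {M : Type*} [AddCommGroup M] [TopologicalSpace M]
  {a : M ≃ₗ[ℤ] M} {V : AddSubgroup M} {A : Type*} [AddCommGroup A] [Finite A]

theorem exists_range_subset_filtration (hV : IsContractingLattice a V) (θ : A →+ M) :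
    ∃ k : ℤ, ∀ c, θ c ∈ filtration a V k := by
  choose k hk using fun c => hV.exists_mem_filtration (θ c)
  obtain ⟨K, hK⟩ := (Set.finite_range k).bddBelow
  exact ⟨K, fun c => hV.filtration_antitone (hK ⟨c, rfl⟩) (hk c)⟩

variable [IsTopologicalAddGroup M] [LocallyCompactSpace M]

theorem summable_entries (hV : IsContractingLattice a V) (θ : A →+ M)
    (y : ShiftGroup (Multiplicative A)) :
    Summable fun n : ℤ => (a ^ n) (θ (y.entry n).toAdd) := by
  obtain ⟨k, hk⟩ := hV.exists_range_subset_filtration θ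
  obtain ⟨N, hN⟩ := y.exists_entry_eq_one
  exact hV.summable_zpow_apply (N := N) (fun n hn => by rw [hN n hn, toAdd_one, map_zero])
    fun n => hk _

variable [T2Space M]

/-- The homomorphism `(x_n)_n ↦ ∑ n, a ^ n (θ x_n)` from a shift group. -/
noncomputable def sumHom (hV : IsContractingLattice a V) (θ : A →+ M) :
    ShiftGroup (Multiplicative A) →* Multiplicative M where
  toFun y := Multiplicative.ofAdd (∑' n : ℤ, (a ^ n) (θ (y.entry n).toAdd))
  map_one' := by simp
  map_mul' x y := by
    rw [← ofAdd_add, ← (hV.summable_entries θ x).tsum_add (hV.summable_entries θ y)]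
    simp only [ShiftGroup.entry_mul, toAdd_mul, map_add]

theorem toAdd_sumHom (hV : IsContractingLattice a V) (θ : A →+ M)
    (y : ShiftGroup (Multiplicative A)) :
    (hV.sumHom θ y).toAdd = ∑' n : ℤ, (a ^ n) (θ (y.entry n).toAdd) := rfl

theorem toAdd_sumHom_shift (hV : IsContractingLattice a V) (θ : A →+ M)
    (y : ShiftGroup (Multiplicative A)) :
    (hV.sumHom θ (ShiftGroup.shift _ y)).toAdd = a (hV.sumHom θ y).toAdd := by
  have ha : Continuous a := by simpa using hV.continuous_zpow 1
  rw [toAdd_sumHom, toAdd_sumHom, ← ((hV.summable_entries θ y).hasSum.map a ha).tsum_eq,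
    ← (Equiv.addRight (1 : ℤ)).tsum_eq]
  refine tsum_congr fun n => ?_
  rw [ShiftGroup.entry_shift, Equiv.coe_addRight, add_sub_cancel_right, zpow_add_one,
    (Commute.zpow_self a n).eq]
  rfl

theorem continuous_sumHom (hV : IsContractingLattice a V) (θ : A →+ M) :
    Continuous (hV.sumHom θ) := by
  have := ShiftGroup.isTopologicalGroup (Multiplicative A)
  refine continuous_of_continuousAt_one _ fun U hU => ?_
  rw [map_one] at hU
  obtain ⟨N, hN⟩ := hV.exists_filtration_subset (U := Multiplicative.ofAdd ⁻¹' U) hU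
  obtain ⟨k, hk⟩ := hV.exists_range_subset_filtration θ
  -- As `θ` maps into step `k`, the term of index `n` lies in step `k + n`, hence in step `N` once
  -- `n ≥ N - k`.
  refine ShiftGroup.mem_nhds_one_iff.mpr ⟨N - k, fun y hy => hN (?_ : (hV.sumHom θ y).toAdd ∈ _)⟩
  refine hV.tsum_mem_filtration fun n => ?_
  rcases lt_or_ge n (N - k) with hn | hn
  · rw [hy n hn, toAdd_one, map_zero, map_zero]
    exact zero_mem _
  · exact zpow_mem_filtration.mpr (hV.filtration_antitone (by omega) (hk _))

theorem isOpenMap_sumHom (hV : IsContractingLattice a V) (θ : A →+ M)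
    (hsurj : Function.Surjective (hV.sumHom θ)) : IsOpenMap (hV.sumHom θ) := by
  have := ShiftGroup.isTopologicalGroup (Multiplicative A)
  have : SigmaCompactSpace (ShiftGroup (Multiplicative A)) := ShiftGroup.sigmaCompactSpace _
  have : BaireSpace (Multiplicative M) := inferInstanceAs (BaireSpace M)
  have : T2Space (Multiplicative M) := inferInstanceAs (T2Space M)
  exact (hV.sumHom θ).isOpenMap_of_sigmaCompact hsurj (hV.continuous_sumHom θ)

/-- A torsion group with a contracting lattice is a shift group. -/
theorem exists_bijective_sumHom (hV : IsContractingLattice a V)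
    (htors : ∀ x : M, ∃ m : ℕ, m ≠ 0 ∧ m • x = 0) :
    ∃ (A : Type) (_ : AddCommGroup A) (_ : Finite A) (θ : A →+ M),
      Function.Bijective (hV.sumHom θ) := by
  let := hV.laurentModule
  have := hV.laurentModule_finite
  obtain ⟨ι, _, q, b, hq, hqb, hspan, hind⟩ := LaurentSeries.exists_basis_of_torsion M htors
  have (i : ι) : NeZero (q i) := ⟨hq i⟩
  let l (i : ι) : ZMod (q i) →+ M :=
    ZMod.lift (q i) ⟨zmultiplesHom M (b i), by simpa using hqb i⟩
  have hl (i : ι) (c : ℤ) : l i c = c • b i := ZMod.lift_coe _ _ _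
  let θ : (∀ i, ZMod (q i)) →+ M := ∑ i, (l i).comp (Pi.evalAddMonoidHom _ i)
  have hθ (c : ι → ℤ) : θ (fun i => (c i : ZMod (q i))) = ∑ i, c i • b i := by
    simp [θ, AddMonoidHom.finsetSum_apply, hl]
  -- Any integral lifts of the entries compute the sum as `∑ f i • b i`, so injectivity and
  -- surjectivity become `hind` and `hspan`.
  have key (y : ShiftGroup (Multiplicative (∀ i, ZMod (q i)))) (f : ι → LaurentSeries ℤ)
      (hyf : ∀ n, (y.entry n).toAdd = fun i => ((f i).coeff n : ZMod (q i))) :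
      (hV.sumHom θ y).toAdd = ∑ i, f i • b i := by
    have h1 : ∑ i, f i • b i = ∑' n : ℤ, ∑ i, (f i).coeff n • (a ^ n) (b i) :=
      (Summable.tsum_finsetSum fun i _ => hV.summable_coeff_smul (f i) (b i)).symm
    rw [h1, toAdd_sumHom]
    refine tsum_congr fun n => ?_
    rw [hyf, hθ, map_sum]
    simp only [map_zsmul]
  refine ⟨∀ i, ZMod (q i), inferInstance, inferInstance, θ, ?_, fun x => ?_⟩
  · refine (injective_iff_map_eq_one _).mpr fun y hy => ?_
    obtain ⟨N, hN⟩ := y.exists_entry_eq_one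
    let f (i : ι) : LaurentSeries ℤ :=
      HahnSeries.ofSuppBddBelow (fun n => (((y.entry n).toAdd i).val : ℤ))
        ⟨N, fun n hn => by
          by_contra! h
          exact hn (by simp [hN n h])⟩
    have hf (n : ℤ) : (y.entry n).toAdd = fun i => ((f i).coeff n : ZMod (q i)) := by
      funext i
      simp [f]
    have h0 := hind f (by rw [← key y f hf, hy, toAdd_one])
    refine ShiftGroup.ext_entry fun n => ?_
    rw [ShiftGroup.entry_one, ← toAdd_eq_zero, hf]
    exact funext fun i => (ZMod.intCast_zmod_eq_zero_iff_dvd _ _).mpr (h0 i n)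
  · obtain ⟨f, hf⟩ := hspan x.toAdd
    choose N hN using fun i => (f i).exists_coeff_eq_zero
    obtain ⟨K, hK⟩ := (Set.finite_range N).bddBelow
    refine ⟨ShiftGroup.ofEntries
      (fun n => Multiplicative.ofAdd fun i => ((f i).coeff n : ZMod (q i))) K fun n hn => ?_, ?_⟩
    · rw [← toAdd_eq_zero]
      funext i
      simp [hN i n (hn.trans_le (hK ⟨i, rfl⟩))]
    · refine Multiplicative.toAdd.injective ?_
      rw [key _ f fun n => by rw [ShiftGroup.entry_ofEntries, toAdd_ofAdd], hf]

end IsContractingLattice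

/-- A torsion abelian totally disconnected locally compact contraction group is isomorphic to the
shift group of a finite abelian group. -/
theorem IsTDLCContractionGroup.exists_iso_shift {G : Type u} [CommGroup G] [TopologicalSpace G]
    {α : G ≃ₜ* G} (hG : IsTDLCContractionGroup G α) (htors : IsMulTorsion G) :
    ∃ (F : Type) (_ : CommGroup F), Finite F ∧ ContractionGroupIso α (ShiftGroup.shift F) := by
  obtain ⟨h1, h2, h3, h4, h5⟩ := hG
  have : T2Space (Additive G) := h2
  have : LocallyCompactSpace (Additive G) := h3
  have : TotallyDisconnectedSpace (Additive G) := h4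
  let a : Additive G ≃ₗ[ℤ] Additive G := α.toMulEquiv.toAdditive.toIntLinearEquiv
  have ha : Continuous a := α.continuous
  have ha' : Continuous ⇑a⁻¹ := α.symm.continuous
  have hpow {c : Additive G ≃ₗ[ℤ] Additive G} (hc : Continuous c) (n : ℕ) :
      Continuous ⇑(c ^ n) := by
    induction n with
    | zero => exact continuous_id
    | succ n ih => rw [pow_succ]; exact ih.comp hc
  have hcont (n : ℤ) : Continuous ⇑(a ^ n) := by
    obtain ⟨k, rfl | rfl⟩ := n.eq_nat_or_neg
    · rw [zpow_natCast]
      exact hpow ha k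
    · rw [zpow_neg, zpow_natCast, ← inv_pow]
      exact hpow ha' k
  have hiter (n : ℕ) (x : Additive G) : (a ^ n) x = Additive.ofMul ((⇑α)^[n] x.toMul) := by
    induction n generalizing x with
    | zero => rfl
    | succ n ih => rw [pow_succ, LinearEquiv.mul_apply, ih]; rfl
  obtain ⟨V, hV⟩ := exists_isContractingLattice hcont fun x =>
    Tendsto.congr (fun n => (hiter n x).symm) (h5 x.toMul)
  obtain ⟨A, _, _, θ, hθ⟩ := hV.exists_bijective_sumHom fun x => by
    obtain ⟨m, hm, hx⟩ := (isOfFinOrder_iff_pow_eq_one.mp (htors x.toMul))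
    exact ⟨m, hm.ne', hx⟩
  let ψ : ShiftGroup (Multiplicative A) ≃* G := MulEquiv.ofBijective (hV.sumHom θ) hθ
  have hψ : Continuous ψ := hV.continuous_sumHom θ
  have hψo : IsOpenMap ψ := hV.isOpenMap_sumHom θ hθ.2
  let Ψ : ShiftGroup (Multiplicative A) ≃ₜ* G :=
    { ψ with
      continuous_toFun := hψ
      continuous_invFun := (ψ.toEquiv.toHomeomorphOfContinuousOpen hψ hψo).symm.continuous }
  refine ⟨Multiplicative A, inferInstance, inferInstance, ContractionGroupIso.symm ⟨Ψ, fun y => ?_⟩⟩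
  exact hV.toAdd_sumHom_shift θ y

theorem ShiftGroup.mul_comm_of_comm (F : Type v) [CommGroup F] (x y : ShiftGroup F) :
    x * y = y * x :=
  ext_entry fun n => by rw [entry_mul, entry_mul, mul_comm]

theorem theoremD :
    -- existence of a finite abelian group `F`
    (∀ (G : Type u) [Group G] [TopologicalSpace G] (α : G ≃ₜ* G),
      IsTDLCContractionGroup G α → (∀ x y : G, x * y = y * x) → IsMulTorsion G →
        ∃ (F : Type) (_ : CommGroup F), Finite F ∧
          ContractionGroupIso α (ShiftGroup.shift F)) ∧
    -- `F` is determined up to isomorphism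
    (∀ (G : Type u) [Group G] [TopologicalSpace G] (α : G ≃ₜ* G),
      IsTDLCContractionGroup G α → (∀ x y : G, x * y = y * x) → IsMulTorsion G →
        ∀ (F : Type v) [CommGroup F] [Finite F] (F' : Type w) [CommGroup F'] [Finite F'],
          ContractionGroupIso α (ShiftGroup.shift F) →
          ContractionGroupIso α (ShiftGroup.shift F') →
          Nonempty (F ≃* F')) ∧
    -- conversely, `F^(-ℕ) × F^(ℕ₀)` with the right shift, and everything isomorphic to it,
    -- is an abelian torsion contraction group
    (∀ (F : Type v) [CommGroup F] [Finite F],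
      IsTDLCContractionGroup (ShiftGroup F) (ShiftGroup.shift F) ∧
      (∀ x y : ShiftGroup F, x * y = y * x) ∧ IsMulTorsion (ShiftGroup F) ∧
      ∀ (G : Type u) [Group G] [TopologicalSpace G] (α : G ≃ₜ* G),
        ContractionGroupIso α (ShiftGroup.shift F) →
          IsTDLCContractionGroup G α ∧ (∀ x y : G, x * y = y * x) ∧ IsMulTorsion G) := by
  refine ⟨fun G _ _ α hG hcomm htors => ?_, fun G _ _ α _ _ _ F _ _ F' _ _ h h' =>
    ShiftGroup.nonempty_mulEquiv_of_iso (h.symm.trans h'), fun F _ _ =>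
    ⟨ShiftGroup.isTDLCContractionGroup F, ShiftGroup.mul_comm_of_comm F,
      ShiftGroup.isMulTorsion F, fun G _ _ α h => ?_⟩⟩
  · let _ : CommGroup G := { ‹Group G› with mul_comm := hcomm }
    exact hG.exists_iso_shift htors
  · refine ⟨(ShiftGroup.isTDLCContractionGroup F).of_iso h, ?_, ?_⟩
    · obtain ⟨φ, -⟩ := h
      exact fun x y => φ.injective (by rw [map_mul, map_mul, ShiftGroup.mul_comm_of_comm F])
    · obtain ⟨φ, -⟩ := h
      exact (ShiftGroup.isMulTorsion F).of_surjective (f := φ.symm.toMonoidHom) φ.symm.surjective
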